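/- For real $X\ge 1$ let $$\Gamma(X)=\sum_{1\le n\le X}\mu^2(n^2+1)\,\mu^2(n^2+2)\,\mu^2(n^2+3),$$ where $\mu$ is the Möbius function and $n$ runs over integers; that is, $\Gamma(X)$ counts the positive integers $n\le X$ for which $n^2+1$, $n^2+2$ and $n^2+3$ are all squarefree. Then the product below, over the primes $p>3$, with $\left(\frac{\cdot}{p}\right)$ the Legendre symbol, converges, and for every $\varepsilon>0$, $$\Gamma(X)=\frac{7}{18}\prod_{p>3}\left(1-\frac{3+\left(\frac{-1}{p}\right)+\left(\frac{-2}{p}\right)+\left(\frac{-3}{p}\right)}{p^2}\right)X+O_\varepsilon\!\left(X^{3/4+\varepsilon}\right)$$ as $X\to\infty$, where the implied constant depends only on $\varepsilon$. In particular, there are infinitely many positive integers $n$ for which $n^2+1$, $n^2+2$ and $n^2+3$ are all squarefree. -/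

import Mathlib

open Filter Asymptotics

/-- `Γ(X) = ∑_{1 ≤ n ≤ X} μ²(n² + 1) μ²(n² + 2) μ²(n² + 3)` for real `X`, where `μ` is the
Möbius function. -/
noncomputable def nearSquareCount (X : ℝ) : ℤ :=
  ∑ n ∈ Finset.Icc 1 ⌊X⌋₊,
    (ArithmeticFunction.moebius (n ^ 2 + 1)) ^ 2 *
      (ArithmeticFunction.moebius (n ^ 2 + 2)) ^ 2 *
      (ArithmeticFunction.moebius (n ^ 2 + 3)) ^ 2

/-- The factor `1 - (3 + (-1/p) + (-2/p) + (-3/p)) / p²` at a prime `p`, with Legendre symbols. -/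
noncomputable def eulerFactor (p : ℕ) [Fact p.Prime] : ℝ :=
  1 - (3 + (legendreSym p (-1) : ℝ) + (legendreSym p (-2) : ℝ) + (legendreSym p (-3) : ℝ)) /
    (p : ℝ) ^ 2

/-!
All three values `n² + 1`, `n² + 2`, `n² + 3` are squarefree exactly when no prime `p` is bad for
`n`, that is, when `p² ∣ n² + i` for no prime `p` and no `i ∈ {1, 2, 3}` (`SqDvd p n`). With
`badProd n` the product of the bad primes, the indicator function is `∑ μ(d)` over
`d ∣ badProd n`. For squarefree `d`, the condition `d ∣ badProd n` is periodic modulo `d²` and, by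
the Chinese remainder theorem, holds in `classCount d = ∏_{p ∣ d} rho p` classes, where `rho p ≤ 6`
(`abs_card_filter_dvd_badProd_sub_le`).

Let `u` be about `X^(1/4)`. The divisors `d ≤ u³` contribute
`X ∑_{d ≤ u³} μ(d) classCount d / d²` with an error `≪ X^ε u³`, and completing the series costs
`≪ X / u ≪ u³`. The divisors `d > u³` only matter for those `n` with `badProd n > u³`. For such an
`n` there are `i` and a squarefree `d > u` with `d² ∣ n² + i` (`exists_large_sq_dvd`). If `d ≤ u³`,
counting residue classes bounds the number of these `n` by `≪ X^ε ∑_{u < d ≤ u³} (X / d² + 1)`,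
which is `≪ X^ε u³`. If `d > u³`, then `n² + i = m d²` with `m ≪ X² / u⁶ ≪ u²`, and for each `m`
there are only `O(log X)` solutions `n ≤ X`: two of them that agree modulo `i` differ by a unit of
norm one of `ℤ[√m]`, so the larger is at least twice the smaller (`two_mul_le_of_sq_add_eq`). Since
`u³ ≤ X^(3/4)`, this is the error term.

The series equals its Euler product `∏ (1 - rho p / p²)`. Here `rho 2 = rho 3 = 2` account for
`1/2 · 7/9 = 7/18`, and for `p > 3` simple roots lift uniquely from `p` to `p²`, so `rho p` is given
by Legendre symbols (`rho_eq_of_three_lt`). The product is positive because all of its factors are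
and the sum of their logarithms converges; hence the count is unbounded.
-/

/-! ### Counting in residue classes -/

/-- `SqDvd p n` says that `p²` divides one of `n² + 1`, `n² + 2`, `n² + 3`. -/
def SqDvd (p n : ℕ) : Prop := p ^ 2 ∣ n ^ 2 + 1 ∨ p ^ 2 ∣ n ^ 2 + 2 ∨ p ^ 2 ∣ n ^ 2 + 3

instance (p : ℕ) : DecidablePred (SqDvd p) := fun n =>
  inferInstanceAs (Decidable (p ^ 2 ∣ n ^ 2 + 1 ∨ p ^ 2 ∣ n ^ 2 + 2 ∨ p ^ 2 ∣ n ^ 2 + 3))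

theorem Function.Periodic.of_dvd_nat {α : Type*} {f : ℕ → α} {a b : ℕ}
    (hf : Function.Periodic f a) (h : a ∣ b) : Function.Periodic f b := by
  obtain ⟨k, rfl⟩ := h
  rw [mul_comm]
  exact hf.nat_mul k

theorem periodic_sq_dvd (q i : ℕ) : Function.Periodic (fun n : ℕ => q ∣ n ^ 2 + i) q := by
  intro n
  simp only [eq_iff_iff]
  rw [show (n + q) ^ 2 + i = (n ^ 2 + i) + q * (2 * n + q) by ring]
  exact (Nat.dvd_add_iff_left (Dvd.intro _ rfl)).symm

theorem periodic_sqDvd (p : ℕ) : Function.Periodic (SqDvd p) (p ^ 2) := by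
  intro n
  unfold SqDvd
  have h := fun i => periodic_sq_dvd (p ^ 2) i n
  simp only at h
  rw [h, h, h]

/-- The Chinese remainder theorem as a count: periodic conditions with coprime periods are
independent. -/
theorem count_and_of_coprime {a b : ℕ} (hab : a.Coprime b) (ha : 0 < a) (hb : 0 < b)
    {P Q : ℕ → Prop} [DecidablePred P] [DecidablePred Q]
    (hP : Function.Periodic P a) (hQ : Function.Periodic Q b) :
    Nat.count (fun n => P n ∧ Q n) (a * b) = Nat.count P a * Nat.count Q b := by
  simp only [Nat.count_eq_card_filter_range]
  rw [← Finset.card_product]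
  refine Finset.card_bij (fun x _ => (x % a, x % b)) ?_ ?_ ?_
  · intro x hx
    simp only [Finset.mem_filter, Finset.mem_range, Finset.mem_product] at hx ⊢
    refine ⟨⟨Nat.mod_lt _ ha, ?_⟩, Nat.mod_lt _ hb, ?_⟩
    · rw [hP.map_mod_nat]; exact hx.2.1
    · rw [hQ.map_mod_nat]; exact hx.2.2
  · intro x hx y hy hxy
    simp only [Finset.mem_filter, Finset.mem_range, Prod.mk.injEq] at hx hy hxy
    have : x ≡ y [MOD a * b] := (Nat.modEq_and_modEq_iff_modEq_mul hab).1 hxy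
    exact Nat.ModEq.eq_of_lt_of_lt this hx.1 hy.1
  · rintro ⟨x, y⟩ hxy
    simp only [Finset.mem_filter, Finset.mem_range, Finset.mem_product] at hxy
    obtain ⟨⟨hx, hPx⟩, hy, hQy⟩ := hxy
    have h1 := (Nat.chineseRemainder hab x y).2
    have h2 := Nat.chineseRemainder_lt_mul hab x y ha.ne' hb.ne'
    set z : ℕ := (Nat.chineseRemainder hab x y : ℕ) with hz
    have e1 : z % a = x := Eq.trans h1.1 (Nat.mod_eq_of_lt hx)
    have e2 : z % b = y := Eq.trans h1.2 (Nat.mod_eq_of_lt hy)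
    refine ⟨z, ?_, by rw [e1, e2]⟩
    simp only [Finset.mem_filter, Finset.mem_range]
    refine ⟨h2, ?_, ?_⟩
    · rw [← hP.map_mod_nat, e1]; exact hPx
    · rw [← hQ.map_mod_nat, e2]; exact hQy

theorem abs_card_filter_Icc_sub_le_of_periodic {q : ℕ} (hq : 0 < q) {P : ℕ → Prop} [DecidablePred P]
    (hP : Function.Periodic P q) (N : ℕ) :
    |(((Finset.Icc 1 N).filter P).card : ℝ) - N * (Nat.count P q / q)| ≤ Nat.count P q := by
  -- Compare with the intervals made of `N / q` and of `N / q + 1` whole periods.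
  have key : ∀ t : ℕ, ((Finset.Ico 1 (1 + q * t)).filter P).card = t * Nat.count P q := by
    intro t
    induction t with
    | zero => simp
    | succ t ih =>
      have h1 : Finset.Ico 1 (1 + q * (t + 1)) =
          Finset.Ico 1 (1 + q * t) ∪ Finset.Ico (1 + q * t) (1 + q * t + q) := by
        rw [Finset.Ico_union_Ico_eq_Ico (by omega) (by omega)]
        congr 1; ring
      rw [h1, Finset.filter_union, Finset.card_union_of_disjoint, ih,
        Nat.filter_Ico_card_eq_of_periodic _ _ _ hP]
      · ring
      · exact Finset.disjoint_filter_filter (Finset.Ico_disjoint_Ico_consecutive _ _ _)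
  set r := Nat.count P q
  have hdiv := Nat.div_add_mod N q
  have hmod := Nat.mod_lt N hq
  set t := N / q
  have lo : t * r ≤ ((Finset.Icc 1 N).filter P).card := by
    rw [← key]
    apply Finset.card_le_card
    apply Finset.filter_subset_filter
    intro x; simp only [Finset.mem_Ico, Finset.mem_Icc]; omega
  have hi : ((Finset.Icc 1 N).filter P).card ≤ (t + 1) * r := by
    rw [← key]
    apply Finset.card_le_card
    apply Finset.filter_subset_filter
    intro x; simp only [Finset.mem_Ico, Finset.mem_Icc, mul_add]; omega
  have lo' : (t * r : ℝ) ≤ ((Finset.Icc 1 N).filter P).card := by exact_mod_cast lo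
  have hi' : (((Finset.Icc 1 N).filter P).card : ℝ) ≤ (t + 1) * r := by exact_mod_cast hi
  have hq' : (0 : ℝ) < q := by exact_mod_cast hq
  have hr : (0 : ℝ) ≤ r := by positivity
  have e1 : (t : ℝ) ≤ N / q := by
    rw [le_div_iff₀ hq']; exact_mod_cast Nat.div_mul_le_self N q
  have e2 : (N : ℝ) / q ≤ t + 1 := by
    rw [div_le_iff₀ hq']; exact_mod_cast (by nlinarith : N ≤ (t + 1) * q)
  have e3 : (N : ℝ) * (r / q) = N / q * r := by ring
  rw [e3, abs_le]
  have f1 := mul_le_mul_of_nonneg_right e1 hr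
  have f2 := mul_le_mul_of_nonneg_right e2 hr
  constructor <;> linarith

/-- The number of residue classes `n` modulo `p²` for which `p²` divides one of `n² + 1`,
`n² + 2`, `n² + 3`. -/
def rho (p : ℕ) : ℕ := Nat.count (SqDvd p) (p ^ 2)

theorem count_forall_sqDvd (S : Finset ℕ) (hS : ∀ p ∈ S, p.Prime) :
    Nat.count (fun n => ∀ p ∈ S, SqDvd p n) ((∏ p ∈ S, p) ^ 2) = ∏ p ∈ S, rho p ∧
    Function.Periodic (fun n => ∀ p ∈ S, SqDvd p n) ((∏ p ∈ S, p) ^ 2) := by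
  have hper : ∀ S : Finset ℕ,
      Function.Periodic (fun n => ∀ p ∈ S, SqDvd p n) ((∏ p ∈ S, p) ^ 2) := by
    intro S n
    simp only [eq_iff_iff]
    refine forall₂_congr fun p hp => ?_
    rw [(periodic_sqDvd p).of_dvd_nat (pow_dvd_pow_of_dvd (Finset.dvd_prod_of_mem _ hp) 2) n]
  refine ⟨?_, hper S⟩
  induction S using Finset.induction_on with
  | empty => simp
  | insert p S hp ih =>
    have ih' := ih fun q hq => hS q (Finset.mem_insert_of_mem hq)
    have hpp := hS p (Finset.mem_insert_self _ _)
    have hcop : (p ^ 2).Coprime ((∏ q ∈ S, q) ^ 2) := by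
      apply Nat.Coprime.pow
      apply Nat.Coprime.prod_right
      intro q hq
      rw [Nat.coprime_primes hpp (hS q (Finset.mem_insert_of_mem hq))]
      rintro rfl; exact hp hq
    have hpos : 0 < (∏ q ∈ S, q) ^ 2 := by
      apply pow_pos
      exact Finset.prod_pos fun q hq => (hS q (Finset.mem_insert_of_mem hq)).pos
    rw [Finset.prod_insert hp, Finset.prod_insert hp, ← ih', mul_pow, rho,
      ← count_and_of_coprime hcop (pow_pos hpp.pos 2) hpos (periodic_sqDvd p) (hper S)]
    simp only [Finset.forall_mem_insert]

/-! ### The local densities -/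

/-- Simple roots lift uniquely: for a prime `p` not dividing `2i`, the congruence
`n² ≡ -i` has as many solutions modulo `p²` as modulo `p`. -/
theorem count_sq_dvd_eq_legendreSym (p : ℕ) [hp : Fact p.Prime] (i : ℕ) (hp2 : p ≠ 2)
    (hi : ¬ p ∣ i) :
    (Nat.count (fun n => p ^ 2 ∣ n ^ 2 + i) (p ^ 2) : ℤ) = legendreSym p (-i) + 1 := by
  have hpp := hp.out
  rw [← legendreSym.card_sqrts p hp2, Nat.count_eq_card_filter_range]
  congr 1
  have hx0 : ∀ x : ℕ, p ∣ x ^ 2 + i → (2 * x).Coprime p := by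
    intro x hx
    rw [Nat.coprime_comm, Nat.Prime.coprime_iff_not_dvd hpp]
    intro h
    rcases (Nat.Prime.dvd_mul hpp).1 h with h | h
    · exact hp2 ((Nat.prime_dvd_prime_iff_eq hpp Nat.prime_two).1 h)
    · exact hi ((Nat.dvd_add_right (dvd_pow h two_ne_zero)).1 hx)
  refine Finset.card_bij (fun x _ => (x : ZMod p)) ?_ ?_ ?_
  · intro x hx
    simp only [Finset.mem_filter, Finset.mem_range, Set.mem_toFinset, Set.mem_ofPred_eq] at hx ⊢
    have h := (dvd_pow_self p two_ne_zero).trans hx.2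
    rw [← ZMod.natCast_eq_zero_iff] at h
    push_cast at h ⊢
    linear_combination h
  · intro x hx y hy hxy
    simp only [Finset.mem_filter, Finset.mem_range] at hx hy
    have hcop : IsCoprime ((p : ℤ) ^ 2) ((x : ℤ) + y) := by
      apply IsCoprime.pow_left
      have h1 : x ≡ y [MOD p] := (ZMod.natCast_eq_natCast_iff _ _ _).1 hxy
      have h2 : x + y ≡ 2 * x [MOD p] := by rw [two_mul]; exact h1.symm.add_left x
      have h3 : p.Coprime (x + y) := by
        rw [Nat.coprime_comm, Nat.Coprime, h2.gcd_eq]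
        exact hx0 x ((dvd_pow_self p two_ne_zero).trans hx.2)
      exact_mod_cast Nat.isCoprime_iff_coprime.2 h3
    have hd : (p : ℤ) ^ 2 ∣ ((x : ℤ) + y) * (x - y) := by
      have h1 : (p : ℤ) ^ 2 ∣ (x : ℤ) ^ 2 + i := by exact_mod_cast hx.2
      have h2 : (p : ℤ) ^ 2 ∣ (y : ℤ) ^ 2 + i := by exact_mod_cast hy.2
      have := dvd_sub h1 h2
      rwa [show (x : ℤ) ^ 2 + i - (y ^ 2 + i) = (x + y) * (x - y) by ring] at this
    have hd2 := hcop.dvd_of_dvd_mul_left hd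
    have : y ≡ x [MOD p ^ 2] := by
      rw [Nat.modEq_iff_dvd]; exact_mod_cast hd2
    exact (Nat.ModEq.eq_of_lt_of_lt this hy.1 hx.1).symm
  · intro z hz
    simp only [Set.mem_toFinset, Set.mem_ofPred_eq] at hz
    set x := z.val with hxdef
    have hxz : (x : ZMod p) = z := ZMod.natCast_zmod_val z
    have hxd : p ∣ x ^ 2 + i := by
      rw [← ZMod.natCast_eq_zero_iff]
      push_cast at hz ⊢
      rw [hxz, hz]; ring
    obtain ⟨k, hk⟩ := hxd
    obtain ⟨s, -, hs⟩ := Nat.exists_mul_mod_eq_one_of_coprime (hx0 x ⟨k, hk⟩) hpp.one_lt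
    -- Newton's step: with `x² + i = p k` and `s` the inverse of `2x` modulo `p`, the root modulo
    -- `p²` is `x - p k s`; the factor `p - 1` replaces `-1` to stay in the naturals.
    set t := k * s * (p - 1) with ht
    refine ⟨(x + p * t) % p ^ 2, ?_, ?_⟩
    · simp only [Finset.mem_filter, Finset.mem_range]
      refine ⟨Nat.mod_lt _ (pow_pos hpp.pos 2), ?_⟩
      have hper := (periodic_sq_dvd (p ^ 2) i).map_mod_nat (x + p * t)
      simp only [eq_iff_iff] at hper
      rw [hper]
      have hs' := Nat.div_add_mod (2 * x * s) p
      rw [hs] at hs'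
      set m := 2 * x * s / p
      obtain ⟨q, rfl⟩ : ∃ q, p = q + 1 := ⟨p - 1, by have := hpp.pos; omega⟩
      rw [Nat.add_sub_cancel] at ht
      refine ⟨k * (1 + m * q) + t ^ 2, ?_⟩
      have e : (x + (q + 1) * t) ^ 2 + i =
        (x ^ 2 + i) + (q + 1) * (2 * x * s) * (k * q) + ((q + 1) * t) ^ 2 := by
        rw [ht]; ring
      rw [e, hk, ← hs']
      ring
    · rw [← hxz, ZMod.natCast_eq_natCast_iff]
      have h1 : (x + p * t) % p ^ 2 ≡ x + p * t [MOD p] :=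
        (Nat.mod_modEq _ _).of_dvd (dvd_pow_self p two_ne_zero)
      exact h1.trans (by simp [Nat.ModEq])

theorem rho_two : rho 2 = 2 := by decide

theorem rho_three : rho 3 = 2 := by decide

theorem rho_eq_of_three_lt (p : ℕ) [hp : Fact p.Prime] (h3 : 3 < p) :
    (rho p : ℤ) = 3 + legendreSym p (-1) + legendreSym p (-2) + legendreSym p (-3) := by
  have hpp := hp.out
  have hnd : ∀ i : ℕ, 0 < i → i ≤ 3 → ¬ p ∣ i := fun i h0 h1 h2 => by
    have := Nat.le_of_dvd h0 h2; omega
  have h1 := count_sq_dvd_eq_legendreSym p 1 (by omega) (hnd 1 (by norm_num) (by norm_num))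
  have h2 := count_sq_dvd_eq_legendreSym p 2 (by omega) (hnd 2 (by norm_num) (by norm_num))
  have h3' := count_sq_dvd_eq_legendreSym p 3 (by omega) (hnd 3 (by norm_num) (by norm_num))
  have hsum : rho p = Nat.count (fun n => p ^ 2 ∣ n ^ 2 + 1) (p ^ 2) +
      Nat.count (fun n => p ^ 2 ∣ n ^ 2 + 2) (p ^ 2) +
      Nat.count (fun n => p ^ 2 ∣ n ^ 2 + 3) (p ^ 2) := by
    have hdisj : ∀ i j n : ℕ, i < j → j ≤ i + 3 → p ^ 2 ∣ n ^ 2 + i → ¬ p ^ 2 ∣ n ^ 2 + j := by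
      intro i j n hij hj ha hb
      have := (Nat.dvd_sub hb ha)
      rw [show n ^ 2 + j - (n ^ 2 + i) = j - i by omega] at this
      have := Nat.le_of_dvd (by omega) this
      have h9 : 4 ^ 2 ≤ p ^ 2 := Nat.pow_le_pow_left h3 2
      omega
    rw [rho]
    simp only [Nat.count_eq_card_filter_range]
    rw [← Finset.card_union_of_disjoint, ← Finset.card_union_of_disjoint]
    · rw [← Finset.filter_or, ← Finset.filter_or]
      congr 1
      ext n
      rw [Finset.mem_filter, Finset.mem_filter, or_assoc, SqDvd]
    · rw [Finset.disjoint_left]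
      intro n hn hn'
      simp only [Finset.mem_filter, Finset.mem_union] at hn hn'
      rcases hn with hn | hn
      · exact hdisj 1 3 n (by norm_num) (by norm_num) hn.2 hn'.2
      · exact hdisj 2 3 n (by norm_num) (by norm_num) hn.2 hn'.2
    · rw [Finset.disjoint_left]
      intro n hn hn'
      simp only [Finset.mem_filter] at hn hn'
      exact hdisj 1 2 n (by norm_num) (by norm_num) hn.2 hn'.2
  rw [hsum]
  push_cast at h1 h2 h3' ⊢
  linarith

theorem legendreSym_le_one (p : ℕ) [Fact p.Prime] (a : ℤ) : legendreSym p a ≤ 1 := by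
  by_cases h : (a : ZMod p) = 0
  · rw [(legendreSym.eq_zero_iff p a).2 h]; norm_num
  · rcases legendreSym.eq_one_or_neg_one p h with h | h <;> simp [h]

theorem rho_le_six {p : ℕ} (hp : p.Prime) : rho p ≤ 6 := by
  have := Fact.mk hp
  rcases lt_or_ge 3 p with h | h
  · have h0 := rho_eq_of_three_lt p h
    have := legendreSym_le_one p (-1)
    have := legendreSym_le_one p (-2)
    have := legendreSym_le_one p (-3)
    omega
  · have := hp.two_le
    interval_cases p
    · rw [rho_two]; norm_num
    · rw [rho_three]; norm_num

theorem eulerFactor_eq (p : ℕ) [Fact p.Prime] (h3 : 3 < p) :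
    eulerFactor p = 1 - rho p / (p : ℝ) ^ 2 := by
  have h := rho_eq_of_three_lt p h3
  have h' : (rho p : ℝ) = 3 + legendreSym p (-1) + legendreSym p (-2) + legendreSym p (-3) := by
    exact_mod_cast h
  rw [eulerFactor, h']

/-! ### Large square divisors of `n² + i` -/

/-- Two solutions of `n² - m d² = -i` that agree modulo `i` differ by a unit `a + b√m` of norm one
with `a ≥ 2`, so the larger `n` is at least twice the smaller one. -/
theorem two_mul_le_of_sq_add_eq {i m n d n' d' : ℕ} (hi : 0 < i) (h : n ^ 2 + i = m * d ^ 2)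
    (h' : n' ^ 2 + i = m * d' ^ 2) (hn : n ≡ n' [MOD i]) (hd : d ≡ d' [MOD i]) (hlt : n < n') :
    2 * n ≤ n' := by
  have hm : 0 < m := by
    rcases Nat.eq_zero_or_pos m with rfl | hm
    · omega
    · exact hm
  have hdd : d < d' := by
    by_contra! hc
    have h1 : d' ^ 2 ≤ d ^ 2 := Nat.pow_le_pow_left hc 2
    have h2 : n ^ 2 < n' ^ 2 := Nat.pow_lt_pow_left hlt two_ne_zero
    have h3 := Nat.mul_le_mul_left m h1
    omega
  obtain ⟨k, hk⟩ := (Nat.modEq_iff_dvd.1 hn)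
  obtain ⟨l, hl⟩ := (Nat.modEq_iff_dvd.1 hd)
  zify at h h' hlt hdd hi hm ⊢
  generalize (i : ℤ) = i, (m : ℤ) = m at *
  have hn0 : (0 : ℤ) ≤ n := by positivity
  have hd0 : (0 : ℤ) ≤ d := by positivity
  generalize (n : ℤ) = n, (n' : ℤ) = n', (d : ℤ) = d, (d' : ℤ) = d' at *
  have e1 : n' = n + i * k := by linarith
  have e2 : d' = d + i * l := by linarith
  -- `a + b√m` is the quotient of `n' + d'√m` by `n + d√m`.
  obtain ⟨a, ha⟩ : ∃ a, i * a = m * d * d' - n * n' :=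
    ⟨1 + m * d * l - n * k, by rw [e1, e2]; linear_combination h⟩
  obtain ⟨b, hb⟩ : ∃ b, i * b = n' * d - n * d' := ⟨k * d - n * l, by rw [e1, e2]; ring⟩
  have hnorm : a ^ 2 = 1 + m * b ^ 2 := by
    have : i ^ 2 * (a ^ 2) = i ^ 2 * (1 + m * b ^ 2) := by
      have : (i * a) ^ 2 - m * (i * b) ^ 2 = i ^ 2 := by
        rw [ha, hb]
        have : (m * d * d' - n * n') ^ 2 - m * (n' * d - n * d') ^ 2 =
          (m * d ^ 2 - n ^ 2) * (m * d' ^ 2 - n' ^ 2) := by ring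
        rw [this, ← h, ← h']; ring
      linear_combination this
    exact mul_left_cancel₀ (by positivity) this
  have hbpos : 0 < b := by
    have h1 : (n * d') ^ 2 < (n' * d) ^ 2 := by
      have : (n' * d) ^ 2 - (n * d') ^ 2 = i * (d' ^ 2 - d ^ 2) := by
        linear_combination d ^ 2 * h' - d' ^ 2 * h
      have : 0 < i * (d' ^ 2 - d ^ 2) := mul_pos hi (by nlinarith)
      linarith
    have h2 : n * d' < n' * d := lt_of_pow_lt_pow_left₀ 2 (by nlinarith) h1
    exact pos_of_mul_pos_right (by linarith : 0 < i * b) hi.le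
  have hapos : 0 < a := by
    have h1 : (n * n') ^ 2 < (m * d * d') ^ 2 := by
      have : (m * d * d') ^ 2 = (n ^ 2 + i) * (n' ^ 2 + i) := by rw [h, h']; ring
      rw [this]
      nlinarith [sq_nonneg n, sq_nonneg n', mul_pos hi hi]
    have hdd' : 0 ≤ d * d' := mul_nonneg hd0 (by linarith)
    have h2 : n * n' < m * d * d' :=
      lt_of_pow_lt_pow_left₀ 2 (by rw [mul_assoc]; exact mul_nonneg hm.le hdd') h1
    exact pos_of_mul_pos_right (by linarith : 0 < i * a) hi.le
  have ha2 : 2 ≤ a := by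
    by_contra! hc
    have : a = 1 := by omega
    rw [this] at hnorm
    have : 0 < m * b ^ 2 := by positivity
    linarith
  have hrec : n' = a * n + b * (m * d) := by
    have : i * n' = i * (a * n + b * (m * d)) := by
      linear_combination n' * h - n * ha - m * d * hb
    exact mul_left_cancel₀ hi.ne' this
  have : 0 ≤ b * (m * d) := by positivity
  nlinarith

open Classical in
/-- For fixed `m` the equation `n² + i = m d²` has `O(log N)` solutions `n ≤ N`: within a class of
`(n, d)` modulo `i`, distinct solutions have distinct binary logarithms. -/
theorem card_filter_exists_sq_add_eq_le {i : ℕ} (hi : 0 < i) (m N : ℕ) :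
    {n ∈ Finset.Icc 1 N | ∃ d, n ^ 2 + i = m * d ^ 2}.card ≤ i ^ 2 * (Nat.log 2 N + 1) := by
  let D : ℕ → ℕ := fun n => if h : ∃ d, n ^ 2 + i = m * d ^ 2 then h.choose else 0
  have hD : ∀ n, (∃ d, n ^ 2 + i = m * d ^ 2) → n ^ 2 + i = m * (D n) ^ 2 := by
    intro n hn
    simp only [D, dif_pos hn]
    exact hn.choose_spec
  have hcard : (Finset.range i ×ˢ Finset.range i ×ˢ Finset.range (Nat.log 2 N + 1)).card =
      i ^ 2 * (Nat.log 2 N + 1) := by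
    simp only [Finset.card_product, Finset.card_range]; ring
  rw [← hcard]
  refine Finset.card_le_card_of_injOn (fun n => (n % i, D n % i, Nat.log 2 n)) ?_ ?_
  · intro n hn
    simp only [Finset.coe_filter, Finset.mem_Icc, Set.mem_ofPred_eq] at hn
    simp only [Finset.coe_product, Set.mem_prod, Finset.coe_range, Set.mem_Iio]
    exact ⟨Nat.mod_lt _ hi, Nat.mod_lt _ hi, Nat.lt_succ_of_le (Nat.log_mono_right hn.1.2)⟩
  · intro n hn n' hn' heq
    simp only [Finset.coe_filter, Finset.mem_Icc, Set.mem_ofPred_eq] at hn hn'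
    simp only [Prod.mk.injEq] at heq
    have key : ∀ n n' : ℕ, 1 ≤ n → n < n' → n ^ 2 + i = m * (D n) ^ 2 →
        n' ^ 2 + i = m * (D n') ^ 2 → n % i = n' % i → D n % i = D n' % i →
        Nat.log 2 n < Nat.log 2 n' := by
      intro n n' h1 hlt h h' hm hd
      have h2 := two_mul_le_of_sq_add_eq hi h h' hm hd hlt
      have h3 := Nat.log_mono_right (b := 2) h2
      rw [mul_comm, Nat.log_mul_base (by norm_num) (by omega)] at h3
      omega
    obtain ⟨q1, q2, q3⟩ := heq
    rcases lt_trichotomy n n' with hlt | h | hlt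
    · have := key n n' hn.1.1 hlt (hD _ hn.2) (hD _ hn'.2) q1 q2
      omega
    · exact h
    · have := key n' n hn'.1.1 hlt (hD _ hn'.2) (hD _ hn.2) q1.symm q2.symm
      omega

open Classical in
/-- If `d² ∣ n² + i` with `d > v`, then `n² + i = m d²` with `m` at most about `N² / v²`. -/
theorem card_filter_exists_large_sq_dvd_le {i : ℕ} (hi : 0 < i) {N M v : ℕ}
    (hM : N ^ 2 + i ≤ M * v ^ 2) :
    {n ∈ Finset.Icc 1 N | ∃ d, v < d ∧ d ^ 2 ∣ n ^ 2 + i}.card ≤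
      M * (i ^ 2 * (Nat.log 2 N + 1)) := by
  have hsub : {n ∈ Finset.Icc 1 N | ∃ d, v < d ∧ d ^ 2 ∣ n ^ 2 + i} ⊆
      (Finset.Icc 1 M).biUnion fun m => {n ∈ Finset.Icc 1 N | ∃ d, n ^ 2 + i = m * d ^ 2} := by
    intro n hn
    simp only [Finset.mem_filter, Finset.mem_Icc, Finset.mem_biUnion] at hn ⊢
    obtain ⟨hn, d, hvd, m, hm⟩ := hn
    refine ⟨m, ⟨?_, ?_⟩, hn, d, by rw [hm, mul_comm]⟩
    · rcases Nat.eq_zero_or_pos m with rfl | h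
      · omega
      · exact h
    · by_contra! hc
      have h1 : n ^ 2 ≤ N ^ 2 := Nat.pow_le_pow_left hn.2 2
      have h2 : v ^ 2 < d ^ 2 := Nat.pow_lt_pow_left hvd two_ne_zero
      have h3 : M * v ^ 2 < d ^ 2 * m := by
        rw [mul_comm]; exact Nat.mul_lt_mul_of_lt_of_lt h2 hc
      omega
  refine (Finset.card_le_card hsub).trans ?_
  refine (Finset.card_biUnion_le_card_mul _ _ _
    fun m _ => card_filter_exists_sq_add_eq_le hi m N).trans ?_
  simp

/-! ### The product of the bad primes -/

/-- The product of the primes `p` whose square divides one of `n² + 1`, `n² + 2`, `n² + 3`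
(all such primes are at most `n + 2`). -/
def badProd (n : ℕ) : ℕ := ∏ p ∈ (Finset.range (n + 3)).filter (fun p => p.Prime ∧ SqDvd p n), p

theorem lt_of_sq_dvd_sq_add {d n i : ℕ} (hi0 : 0 < i) (hi : i ≤ 3) (h : d ^ 2 ∣ n ^ 2 + i) :
    d < n + 3 := by
  have h1 := Nat.le_of_dvd (by positivity) h
  by_contra! hc
  nlinarith [Nat.pow_le_pow_left hc 2]

theorem SqDvd.lt {p n : ℕ} (h : SqDvd p n) : p < n + 3 := by
  rcases h with h | h | h
  · exact lt_of_sq_dvd_sq_add (by norm_num) (by norm_num) h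
  · exact lt_of_sq_dvd_sq_add (by norm_num) (by norm_num) h
  · exact lt_of_sq_dvd_sq_add (by norm_num) (by norm_num) h

theorem primeFactors_badProd (n : ℕ) :
    (badProd n).primeFactors = (Finset.range (n + 3)).filter (fun p => p.Prime ∧ SqDvd p n) :=
  Nat.primeFactors_prod fun _ hp => (Finset.mem_filter.1 hp).2.1

theorem mem_primeFactors_badProd {p n : ℕ} :
    p ∈ (badProd n).primeFactors ↔ p.Prime ∧ SqDvd p n := by
  rw [primeFactors_badProd, Finset.mem_filter, Finset.mem_range]
  exact ⟨fun h => h.2, fun h => ⟨h.2.lt, h⟩⟩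

theorem badProd_pos (n : ℕ) : 0 < badProd n :=
  Finset.prod_pos fun _ hp => (Finset.mem_filter.1 hp).2.1.pos

theorem squarefree_badProd (n : ℕ) : Squarefree (badProd n) := by
  refine Finset.squarefree_prod_of_pairwise_isCoprime ?_ ?_
  · intro p hp q hq hpq
    simp only [Finset.coe_filter, Set.mem_ofPred_eq] at hp hq
    exact Nat.coprime_iff_isRelPrime.1 ((Nat.coprime_primes hp.2.1 hq.2.1).2 hpq)
  · intro p hp
    exact (Finset.mem_filter.1 hp).2.1.prime.squarefree

theorem dvd_badProd_iff {d n : ℕ} :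
    d ∣ badProd n ↔ Squarefree d ∧ ∀ p ∈ d.primeFactors, SqDvd p n := by
  constructor
  · intro h
    exact ⟨(squarefree_badProd n).squarefree_of_dvd h, fun p hp =>
      (mem_primeFactors_badProd.1 (Nat.primeFactors_mono h (badProd_pos n).ne' hp)).2⟩
  · rintro ⟨hd, h⟩
    rw [← Nat.prod_primeFactors_of_squarefree hd,
      ← Nat.prod_primeFactors_of_squarefree (squarefree_badProd n)]
    exact Finset.prod_dvd_prod_of_subset _ _ _ fun p hp =>
      mem_primeFactors_badProd.2 ⟨Nat.prime_of_mem_primeFactors hp, h p hp⟩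

theorem dvd_badProd_of_sq_dvd {d n i : ℕ} (hd : Squarefree d) (hi : i = 1 ∨ i = 2 ∨ i = 3)
    (h : d ^ 2 ∣ n ^ 2 + i) : d ∣ badProd n := by
  refine dvd_badProd_iff.2 ⟨hd, fun p hp => ?_⟩
  have h1 := (pow_dvd_pow_of_dvd (Nat.dvd_of_mem_primeFactors hp) 2).trans h
  rcases hi with rfl | rfl | rfl
  · exact Or.inl h1
  · exact Or.inr (Or.inl h1)
  · exact Or.inr (Or.inr h1)

theorem badProd_eq_one_iff (n : ℕ) : badProd n = 1 ↔
    Squarefree (n ^ 2 + 1) ∧ Squarefree (n ^ 2 + 2) ∧ Squarefree (n ^ 2 + 3) := by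
  rw [← Nat.primeFactors_eq_empty.trans
    (or_iff_right (badProd_pos n).ne'), Finset.eq_empty_iff_forall_notMem]
  simp only [mem_primeFactors_badProd, Nat.squarefree_iff_prime_squarefree, SqDvd, ← pow_two]
  constructor
  · intro h
    refine ⟨fun p hp h1 => h p ⟨hp, Or.inl h1⟩, fun p hp h1 => h p ⟨hp, Or.inr (Or.inl h1)⟩,
      fun p hp h1 => h p ⟨hp, Or.inr (Or.inr h1)⟩⟩
  · rintro ⟨h1, h2, h3⟩ p ⟨hp, h | h | h⟩
    · exact h1 p hp h
    · exact h2 p hp h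
    · exact h3 p hp h

/-- Legendre's identity for the indicator function of the squarefree triples. -/
theorem moebius_sq_mul_eq_sum (n : ℕ) :
    (ArithmeticFunction.moebius (n ^ 2 + 1)) ^ 2 * (ArithmeticFunction.moebius (n ^ 2 + 2)) ^ 2 *
      (ArithmeticFunction.moebius (n ^ 2 + 3)) ^ 2 =
    ∑ d ∈ (badProd n).divisors, ArithmeticFunction.moebius d := by
  have h1 : ∑ d ∈ (badProd n).divisors, ArithmeticFunction.moebius d =
      if badProd n = 1 then 1 else 0 := by
    rw [← ArithmeticFunction.coe_zeta_mul_apply, ArithmeticFunction.coe_zeta_mul_moebius,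
      ArithmeticFunction.one_apply]
  rw [h1]
  simp only [ArithmeticFunction.moebius_sq, badProd_eq_one_iff]
  split_ifs <;> simp_all

/-- `badProd n` is at most the product over `i = 1, 2, 3` of the products of the primes whose
squares divide `n² + i`, so one of these three exceeds `u`. -/
theorem exists_large_sq_dvd {n u : ℕ} (h : u ^ 3 < badProd n) :
    ∃ i ∈ Finset.Icc 1 3, ∃ d, u < d ∧ Squarefree d ∧ d ^ 2 ∣ n ^ 2 + i := by
  classical
  set S : ℕ → Finset ℕ := fun i => (badProd n).primeFactors.filter (fun p => p ^ 2 ∣ n ^ 2 + i)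
    with hS
  set D : ℕ → ℕ := fun i => ∏ p ∈ S i, p with hD
  have hprime : ∀ i, ∀ p ∈ S i, p.Prime := fun i p hp =>
    Nat.prime_of_mem_primeFactors (Finset.mem_filter.1 hp).1
  have hDsq : ∀ i, Squarefree (D i) := fun i =>
    (squarefree_badProd n).squarefree_of_dvd (by
      rw [← Nat.prod_primeFactors_of_squarefree (squarefree_badProd n)]
      exact Finset.prod_dvd_prod_of_subset _ _ _ (Finset.filter_subset _ _))
  have hDdvd : ∀ i, (D i) ^ 2 ∣ n ^ 2 + i := by
    intro i
    rw [hD, ← Finset.prod_pow]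
    refine Finset.prod_dvd_of_isRelPrime ?_ ?_
    · intro p hp q hq hpq
      exact Nat.coprime_iff_isRelPrime.1
        (Nat.Coprime.pow 2 2 ((Nat.coprime_primes (hprime i p hp) (hprime i q hq)).2 hpq))
    · intro p hp
      exact (Finset.mem_filter.1 hp).2
  have hDpos : ∀ i, 0 < D i := fun i => Finset.prod_pos fun p hp => (hprime i p hp).pos
  have hle : badProd n ≤ D 1 * D 2 * D 3 := by
    have hd : badProd n ∣ D 1 * D 2 * D 3 := by
      conv_lhs => rw [← Nat.prod_primeFactors_of_squarefree (squarefree_badProd n)]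
      refine Finset.prod_dvd_of_isRelPrime ?_ ?_
      · intro p hp q hq hpq
        exact Nat.coprime_iff_isRelPrime.1 ((Nat.coprime_primes
          (Nat.prime_of_mem_primeFactors hp) (Nat.prime_of_mem_primeFactors hq)).2 hpq)
      · intro p hp
        have hd : ∀ i, p ^ 2 ∣ n ^ 2 + i → p ∣ D i := fun i hi =>
          Finset.dvd_prod_of_mem _ (Finset.mem_filter.2 ⟨hp, hi⟩)
        rcases (mem_primeFactors_badProd.1 hp).2 with h | h | h
        · exact ((hd 1 h).mul_right _).mul_right _
        · exact ((hd 2 h).mul_left _).mul_right _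
        · exact (hd 3 h).mul_left _
    exact Nat.le_of_dvd (mul_pos (mul_pos (hDpos 1) (hDpos 2)) (hDpos 3)) hd
  by_contra! hc
  have hu : ∀ i ∈ Finset.Icc 1 3, D i ≤ u := by
    intro i hi
    by_contra! hlt
    exact hc i hi (D i) hlt (hDsq i) (hDdvd i)
  have : D 1 * D 2 * D 3 ≤ u * u * u :=
    Nat.mul_le_mul (Nat.mul_le_mul (hu 1 (by simp)) (hu 2 (by simp))) (hu 3 (by simp))
  rw [show u * u * u = u ^ 3 by ring] at this
  omega

/-- The multiplicative extension of `rho` to squarefree arguments: the number of residue classes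
modulo `d²` in which `d ∣ badProd n`. -/
def classCount (d : ℕ) : ℕ := ∏ p ∈ d.primeFactors, rho p

/-- The number of `n ≤ N` with `d ∣ badProd n` is `N classCount d / d²` up to `classCount d`. -/
theorem abs_card_filter_dvd_badProd_sub_le {d : ℕ} (hd : Squarefree d) (N : ℕ) :
    |(({n ∈ Finset.Icc 1 N | d ∣ badProd n}.card : ℕ) : ℝ) - N * (classCount d / (d : ℝ) ^ 2)| ≤
      classCount d := by
  have h := count_forall_sqDvd d.primeFactors fun p hp => Nat.prime_of_mem_primeFactors hp
  rw [Nat.prod_primeFactors_of_squarefree hd] at h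
  have h2 := abs_card_filter_Icc_sub_le_of_periodic (pow_pos (Nat.pos_of_ne_zero hd.ne_zero) 2) h.2 N
  rw [h.1] at h2
  have h3 : {n ∈ Finset.Icc 1 N | d ∣ badProd n} =
      {n ∈ Finset.Icc 1 N | ∀ p ∈ d.primeFactors, SqDvd p n} := by
    refine Finset.filter_congr fun n _ => ?_
    rw [dvd_badProd_iff]
    exact and_iff_right hd
  rw [h3]
  rw [classCount]
  push_cast at h2 ⊢
  exact h2

theorem classCount_le (d : ℕ) : classCount d ≤ 6 ^ d.primeFactors.card :=
  Finset.prod_le_pow_card _ _ _ fun _ hp => rho_le_six (Nat.prime_of_mem_primeFactors hp)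

theorem card_divisors_le_of_squarefree {d : ℕ} (hd : Squarefree d) :
    d.divisors.card ≤ 6 ^ d.primeFactors.card := by
  rw [Nat.card_divisors hd.ne_zero]
  refine Finset.prod_le_pow_card _ _ _ fun p _ => ?_
  have := hd.natFactorization_le_one p
  omega

/-- A larger `badProd n` would force some `d > 4n²` with `d² ∣ n² + i`. -/
theorem badProd_le (n : ℕ) (hn : 0 < n) : badProd n ≤ 64 * n ^ 6 := by
  by_contra! hc
  obtain ⟨i, hi, d, hd, -, hdvd⟩ := exists_large_sq_dvd (u := 4 * n ^ 2)
    (by rw [show (4 * n ^ 2) ^ 3 = 64 * n ^ 6 by ring]; exact hc)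
  rw [Finset.mem_Icc] at hi
  have := lt_of_sq_dvd_sq_add hi.1 hi.2 hdvd
  nlinarith

/-- `6 ^ ω(d) ≪ d ^ δ`, where `ω` counts the distinct prime factors. -/
theorem exists_six_pow_card_primeFactors_le {δ : ℝ} (hδ : 0 < δ) :
    ∃ C : ℝ, 1 ≤ C ∧ ∀ d : ℕ, 0 < d → (6 : ℝ) ^ d.primeFactors.card ≤ C * (d : ℝ) ^ δ := by
  -- Primes `p ≥ 6 ^ (1 / δ)` satisfy `6 ≤ p ^ δ`; the others contribute a bounded factor.
  obtain ⟨B, hB⟩ := exists_nat_ge ((6 : ℝ) ^ (1 / δ))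
  refine ⟨6 ^ B, one_le_pow₀ (by norm_num), fun d hd => ?_⟩
  have hsplit : ∀ p ∈ d.primeFactors, (6 : ℝ) ≤ (if p < B then 6 else 1) * (p : ℝ) ^ δ := by
    intro p hp
    have hp1 : (1 : ℝ) ≤ p := by exact_mod_cast (Nat.prime_of_mem_primeFactors hp).one_le
    split_ifs with h
    · nlinarith [Real.one_le_rpow hp1 hδ.le]
    · push Not at h
      have h1 : (6 : ℝ) ^ (1 / δ) ≤ p := hB.trans (by exact_mod_cast h)
      have h2 := Real.rpow_le_rpow (by positivity) h1 hδ.le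
      rw [← Real.rpow_mul (by norm_num), one_div_mul_cancel hδ.ne', Real.rpow_one] at h2
      linarith
  calc (6 : ℝ) ^ d.primeFactors.card = ∏ p ∈ d.primeFactors, (6 : ℝ) := by simp
    _ ≤ ∏ p ∈ d.primeFactors, ((if p < B then 6 else 1) * (p : ℝ) ^ δ) :=
        Finset.prod_le_prod (fun _ _ => by norm_num) hsplit
    _ = (∏ p ∈ d.primeFactors, (if p < B then (6 : ℝ) else 1)) *
          (((∏ p ∈ d.primeFactors, p : ℕ) : ℝ)) ^ δ := by
        rw [Finset.prod_mul_distrib]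
        push_cast
        rw [Real.finsetProd_rpow _ _ fun p _ => by positivity]
    _ ≤ 6 ^ B * (d : ℝ) ^ δ := by
        gcongr
        · rw [← Finset.prod_filter, Finset.prod_const]
          refine pow_le_pow_right₀ (by norm_num) ?_
          calc _ ≤ (Finset.range B).card := Finset.card_le_card fun p hp =>
                Finset.mem_range.2 (Finset.mem_filter.1 hp).2
            _ = B := Finset.card_range B
        · exact Nat.le_of_dvd hd (Nat.prod_primeFactors_dvd d)

/-! ### The singular series and its Euler product -/

/-- The terms `μ(d) w(d) / d²` of the singular series, `w` being `classCount`. -/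
noncomputable def densityTerm (d : ℕ) : ℝ :=
  ArithmeticFunction.moebius d * (classCount d / (d : ℝ) ^ 2)

theorem abs_moebius_le_one_real (d : ℕ) : |(ArithmeticFunction.moebius d : ℝ)| ≤ 1 := by
  exact_mod_cast ArithmeticFunction.abs_moebius_le_one

theorem exists_abs_densityTerm_le :
    ∃ C : ℝ, 0 ≤ C ∧ ∀ d : ℕ, |densityTerm d| ≤ C * (d : ℝ) ^ (-(11 / 6) : ℝ) := by
  obtain ⟨C, hC, h⟩ := exists_six_pow_card_primeFactors_le (δ := 1 / 6) (by norm_num)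
  refine ⟨C, by linarith, fun d => ?_⟩
  rcases Nat.eq_zero_or_pos d with rfl | hd
  · simp [densityTerm]
  · have hd' : (0 : ℝ) < d := by exact_mod_cast hd
    have h1 : (classCount d : ℝ) ≤ C * (d : ℝ) ^ (1 / 6 : ℝ) :=
      le_trans (by exact_mod_cast classCount_le d) (h d hd)
    rw [densityTerm, abs_mul, abs_of_nonneg (by positivity : 0 ≤ (classCount d : ℝ) / (d : ℝ) ^ 2)]
    calc _ ≤ 1 * (C * (d : ℝ) ^ (1 / 6 : ℝ) / (d : ℝ) ^ 2) := by
          gcongr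
          exact abs_moebius_le_one_real d
      _ = C * (d : ℝ) ^ (-(11 / 6) : ℝ) := by
          rw [one_mul, mul_div_assoc, ← Real.rpow_natCast, ← Real.rpow_sub hd']
          norm_num

theorem summable_densityTerm : Summable densityTerm := by
  obtain ⟨C, -, h⟩ := exists_abs_densityTerm_le
  exact Summable.of_norm_bounded
    ((Real.summable_nat_rpow.2 (by norm_num : (-(11 / 6) : ℝ) < -1)).mul_left C) h

/-- The tail beyond `u³`: for `d > u³` one has `d ^ (-11/6) ≤ u⁻¹ d ^ (-3/2)`. -/
theorem exists_abs_tsum_densityTerm_sub_le : ∃ C : ℝ, 0 ≤ C ∧ ∀ u : ℕ, 0 < u →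
    |(∑' d, densityTerm d) - ∑ d ∈ Finset.Icc 1 (u ^ 3), densityTerm d| ≤ C / u := by
  obtain ⟨C, hC, h⟩ := exists_abs_densityTerm_le
  have hs := Real.summable_nat_rpow.2 (by norm_num : (-(3 / 2) : ℝ) < -1)
  refine ⟨C * ∑' d : ℕ, (d : ℝ) ^ (-(3 / 2) : ℝ),
    mul_nonneg hC (tsum_nonneg fun d => by positivity), fun u hu => ?_⟩
  have hu' : (0 : ℝ) < u := by exact_mod_cast hu
  set s := Finset.Icc 1 (u ^ 3)
  have h1 : HasSum (fun d => densityTerm d - (s : Set ℕ).indicator densityTerm d)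
      ((∑' d, densityTerm d) - ∑ d ∈ s, densityTerm d) := by
    refine summable_densityTerm.hasSum.sub ?_
    rw [← hasSum_subtype_iff_indicator]
    exact s.hasSum densityTerm
  rw [← h1.tsum_eq, ← Real.norm_eq_abs]
  refine tsum_of_norm_bounded (g := fun d : ℕ => C / u * (d : ℝ) ^ (-(3 / 2) : ℝ)) ?_ ?_
  · rw [mul_div_right_comm]
    exact hs.hasSum.mul_left (C / u)
  · intro d
    by_cases hd : d ∈ (s : Set ℕ)
    · rw [Set.indicator_of_mem hd, sub_self, norm_zero]; positivity
    · rw [Set.indicator_of_notMem hd, sub_zero, Real.norm_eq_abs]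
      rcases Nat.eq_zero_or_pos d with rfl | hd0
      · simp [densityTerm]
      · have hd1 : u ^ 3 < d := by
          simp only [s, Finset.coe_Icc, Set.mem_Icc, not_and, not_le] at hd
          exact hd hd0
        have hd' : (0 : ℝ) < d := by exact_mod_cast hd0
        have h2 : (d : ℝ) ^ (-(1 / 3) : ℝ) ≤ (u : ℝ)⁻¹ := by
          have h3 : ((u : ℝ) ^ 3) ≤ d := by exact_mod_cast hd1.le
          calc (d : ℝ) ^ (-(1 / 3) : ℝ) ≤ ((u : ℝ) ^ 3) ^ (-(1 / 3) : ℝ) :=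
                Real.rpow_le_rpow_of_nonpos (by positivity) h3 (by norm_num)
            _ = (u : ℝ)⁻¹ := by
                rw [← Real.rpow_natCast, ← Real.rpow_mul hu'.le]
                norm_num [Real.rpow_neg_one]
        calc |densityTerm d| ≤ C * (d : ℝ) ^ (-(11 / 6) : ℝ) := h d
          _ = C * ((d : ℝ) ^ (-(1 / 3) : ℝ) * (d : ℝ) ^ (-(3 / 2) : ℝ)) := by
              rw [← Real.rpow_add hd']; norm_num
          _ ≤ C * ((u : ℝ)⁻¹ * (d : ℝ) ^ (-(3 / 2) : ℝ)) := by gcongr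
          _ = C / u * (d : ℝ) ^ (-(3 / 2) : ℝ) := by ring

theorem classCount_mul_of_coprime {m n : ℕ} (h : m.Coprime n) :
    classCount (m * n) = classCount m * classCount n := by
  rw [classCount, h.primeFactors_mul, Finset.prod_union h.disjoint_primeFactors]
  rfl

theorem tsum_densityTerm_prime_pow {p : ℕ} (hp : p.Prime) :
    ∑' e, densityTerm (p ^ e) = 1 - rho p / (p : ℝ) ^ 2 := by
  rw [tsum_eq_sum (s := Finset.range 2)]
  · simp [Finset.sum_range_succ, densityTerm, classCount, hp.primeFactors,
      ArithmeticFunction.moebius_apply_prime hp, sub_eq_add_neg]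
  · intro e he
    rw [Finset.mem_range, not_lt] at he
    rw [densityTerm, ArithmeticFunction.moebius_eq_zero_of_not_squarefree, Int.cast_zero, zero_mul]
    intro hsq
    have := (Nat.squarefree_pow_iff hp.one_lt.ne' (by omega : e ≠ 0)).1 hsq
    omega

theorem hasProd_tsum_densityTerm :
    HasProd (Set.mulIndicator {p | Nat.Prime p} fun p : ℕ => 1 - rho p / (p : ℝ) ^ 2)
      (∑' d, densityTerm d) := by
  have hone : densityTerm 1 = 1 := by simp [densityTerm, classCount]
  have hzero : densityTerm 0 = 0 := by simp [densityTerm]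
  have hmul : ∀ {m n : ℕ}, m.Coprime n →
      densityTerm (m * n) = densityTerm m * densityTerm n := by
    intro m n hmn
    rw [densityTerm, densityTerm, densityTerm, classCount_mul_of_coprime hmn,
      ArithmeticFunction.isMultiplicative_moebius.map_mul_of_coprime hmn]
    push_cast
    ring
  have he : Set.mulIndicator {p | Nat.Prime p} (fun p : ℕ => ∑' e, densityTerm (p ^ e)) =
      Set.mulIndicator {p | Nat.Prime p} fun p : ℕ => 1 - rho p / (p : ℝ) ^ 2 :=
    Set.mulIndicator_congr fun p hp => tsum_densityTerm_prime_pow hp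
  rw [← he]
  exact EulerProduct.eulerProduct_hasProd_mulIndicator hone hmul summable_densityTerm.norm hzero

theorem eulerFactor_pos (p : ℕ) [Fact p.Prime] (h3 : 3 < p) : 0 < eulerFactor p := by
  have hp := Fact.out (p := p.Prime)
  have h5 : 5 ≤ p := by
    by_contra! hc
    have : p = 4 := by omega
    subst this
    revert hp; norm_num
  have h6 : (rho p : ℝ) ≤ 6 := by exact_mod_cast rho_le_six hp
  have h7 : (5 : ℝ) ≤ p := by exact_mod_cast h5
  rw [eulerFactor_eq p h3, sub_pos, div_lt_one (by positivity)]
  nlinarith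

theorem summable_log_eulerFactor : Summable
    (fun p : {p : ℕ // p.Prime ∧ 3 < p} => Real.log (@eulerFactor (p : ℕ) ⟨p.property.1⟩)) := by
  have h1 : Summable (fun p : {p : ℕ // p.Prime ∧ 3 < p} =>
      -((rho (p : ℕ) : ℝ) / ((p : ℕ) : ℝ) ^ 2)) := by
    have h2 : Summable (fun n : ℕ => 6 * ((n : ℝ) ^ 2)⁻¹) :=
      (Real.summable_nat_pow_inv.2 one_lt_two).mul_left 6
    refine Summable.of_norm_bounded
      (h2.comp_injective (Subtype.val_injective (p := fun p : ℕ => p.Prime ∧ 3 < p))) ?_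
    intro p
    have h6 : (rho (p : ℕ) : ℝ) ≤ 6 := by exact_mod_cast rho_le_six p.2.1
    rw [norm_neg, Real.norm_of_nonneg (by positivity), div_eq_mul_inv, Function.comp_apply]
    gcongr
  refine (Real.summable_log_one_add_of_summable h1).congr fun p => ?_
  have : Fact (p : ℕ).Prime := ⟨p.2.1⟩
  rw [eulerFactor_eq _ p.2.2, sub_eq_add_neg]

theorem multipliable_eulerFactor : Multipliable
    (fun p : {p : ℕ // p.Prime ∧ 3 < p} => @eulerFactor (p : ℕ) ⟨p.property.1⟩) :=
  Real.multipliable_of_summable_log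
    (fun p => @eulerFactor_pos _ ⟨p.property.1⟩ p.property.2) summable_log_eulerFactor

theorem tprod_eulerFactor_pos :
    0 < ∏' p : {p : ℕ // p.Prime ∧ 3 < p}, @eulerFactor (p : ℕ) ⟨p.property.1⟩ := by
  rw [← Real.rexp_tsum_eq_tprod
    (fun p => @eulerFactor_pos _ ⟨p.property.1⟩ p.property.2) summable_log_eulerFactor]
  exact Real.exp_pos _

theorem tsum_densityTerm_eq : ∑' d, densityTerm d =
    7 / 18 * ∏' p : {p : ℕ // p.Prime ∧ 3 < p}, @eulerFactor (p : ℕ) ⟨p.property.1⟩ := by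
  set F : ℕ → ℝ := fun p => 1 - rho p / (p : ℝ) ^ 2
  have h1 : HasProd (Set.mulIndicator {p : ℕ | p.Prime ∧ 3 < p} F)
      (∏' p : {p : ℕ // p.Prime ∧ 3 < p}, @eulerFactor (p : ℕ) ⟨p.property.1⟩) := by
    rw [← hasProd_subtype_iff_mulIndicator]
    have he : (fun p : {p : ℕ // p.Prime ∧ 3 < p} => @eulerFactor (p : ℕ) ⟨p.property.1⟩) =
        F ∘ Subtype.val := funext fun p => @eulerFactor_eq _ ⟨p.2.1⟩ p.2.2
    have h := multipliable_eulerFactor.hasProd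
    rw [he] at h ⊢
    exact h
  have h2 : HasProd (Set.mulIndicator (({2, 3} : Finset ℕ) : Set ℕ) F) (7 / 18) := by
    rw [← hasProd_subtype_iff_mulIndicator]
    convert Finset.hasProd ({2, 3} : Finset ℕ) F using 1
    rw [Finset.prod_pair (by norm_num)]
    simp only [F, rho_two, rho_three]
    norm_num
  refine hasProd_tsum_densityTerm.unique ?_
  convert h2.mul h1 using 1
  rw [← Set.mulIndicator_union_of_disjoint]
  · congr 1
    ext p
    simp only [Set.mem_ofPred_eq, Finset.coe_insert, Finset.coe_singleton, Set.mem_union,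
      Set.mem_insert_iff, Set.mem_singleton_iff]
    constructor
    · intro hp
      by_cases h : 3 < p
      · exact Or.inr ⟨hp, h⟩
      · have := hp.two_le
        exact Or.inl (by omega)
    · rintro ((rfl | rfl) | h)
      · exact Nat.prime_two
      · exact Nat.prime_three
      · exact h.1
  · rw [Set.disjoint_left]
    rintro p hp ⟨-, h⟩
    simp at hp
    omega

/-! ### The sieve -/

/-- A bound for the number of `n ≤ N` with `badProd n` beyond the sieving level `u³`, where `u` is about
`N ^ (1/4)`: such an `n` has a squarefree `d > u` with `d² ∣ n² + i`. For `d ≤ u³` these are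
counted by congruences, for `d > u³` by the bound for `n² + i = m d²` with `m ≪ u²`. -/
theorem card_filter_lt_badProd_le {N u : ℕ} {K L : ℝ} (hu : 0 < u) (hlo : u ^ 4 ≤ N)
    (hhi : N ≤ 16 * u ^ 4)
    (hK : ∀ d : ℕ, 0 < d → d ≤ 64 * N ^ 6 → (6 : ℝ) ^ d.primeFactors.card ≤ K)
    (hL : (Nat.log 2 N : ℝ) + 1 ≤ L) :
    ({n ∈ Finset.Icc 1 N | u ^ 3 < badProd n}.card : ℝ) ≤ (17 * K + 13824 * L) * u ^ 3 := by
  classical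
  have hN : 0 < N := lt_of_lt_of_le (by positivity) hlo
  have huN : u ^ 3 ≤ 64 * N ^ 6 := by
    have h1 : u ^ 3 ≤ u ^ 4 := Nat.pow_le_pow_right hu (by norm_num)
    have h2 : N ≤ N ^ 6 := Nat.le_self_pow (by norm_num) N
    omega
  have hsub : {n ∈ Finset.Icc 1 N | u ^ 3 < badProd n} ⊆
      ({d ∈ Finset.Ioc u (u ^ 3) | Squarefree d}.biUnion
        fun d => {n ∈ Finset.Icc 1 N | d ∣ badProd n}) ∪
      (Finset.Icc 1 3).biUnion
        fun i => {n ∈ Finset.Icc 1 N | ∃ d, u ^ 3 < d ∧ d ^ 2 ∣ n ^ 2 + i} := by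
    intro n hn
    rw [Finset.mem_filter] at hn
    obtain ⟨i, hi, d, hud, hsq, hd⟩ := exists_large_sq_dvd hn.2
    rw [Finset.mem_union]
    rcases lt_or_ge (u ^ 3) d with h | h
    · refine Or.inr (Finset.mem_biUnion.2 ⟨i, hi, Finset.mem_filter.2 ⟨hn.1, d, h, hd⟩⟩)
    · refine Or.inl (Finset.mem_biUnion.2 ⟨d, Finset.mem_filter.2 ⟨Finset.mem_Ioc.2 ⟨hud, h⟩, hsq⟩,
        Finset.mem_filter.2 ⟨hn.1, dvd_badProd_of_sq_dvd hsq ?_ hd⟩⟩)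
      rw [Finset.mem_Icc] at hi; omega
  have hu' : (1 : ℝ) ≤ u := by exact_mod_cast hu
  have hhi' : (N : ℝ) ≤ 16 * (u : ℝ) ^ 4 := by exact_mod_cast hhi
  have hK0 : 0 ≤ K :=
    le_trans (by positivity) (hK 1 one_pos (by nlinarith [Nat.pow_pos (n := 6) hN]))
  have hlarge : (((Finset.Icc 1 3).biUnion
      fun i => {n ∈ Finset.Icc 1 N | ∃ d, u ^ 3 < d ∧ d ^ 2 ∣ n ^ 2 + i}).card : ℝ) ≤
      13824 * L * u ^ 3 := by
    have h1 : ((Finset.Icc 1 3).biUnion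
        fun i => {n ∈ Finset.Icc 1 N | ∃ d, u ^ 3 < d ∧ d ^ 2 ∣ n ^ 2 + i}).card ≤
        3 * (512 * u ^ 2 * (9 * (Nat.log 2 N + 1))) := by
      refine (Finset.card_biUnion_le_card_mul _ _ (512 * u ^ 2 * (9 * (Nat.log 2 N + 1)))
        fun i hi => ?_).trans (by simp)
      rw [Finset.mem_Icc] at hi
      refine (card_filter_exists_large_sq_dvd_le hi.1 (M := 512 * u ^ 2) (v := u ^ 3) ?_).trans ?_
      · have h2 : N ^ 2 ≤ (16 * u ^ 4) ^ 2 := Nat.pow_le_pow_left hhi 2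
        have h3 : 1 ≤ u ^ 8 := Nat.one_le_pow _ _ hu
        calc N ^ 2 + i ≤ (16 * u ^ 4) ^ 2 + 256 * u ^ 8 := by omega
          _ = 512 * u ^ 2 * (u ^ 3) ^ 2 := by ring
      · have : i ^ 2 ≤ 9 := by nlinarith
        gcongr
    calc _ ≤ ((3 * (512 * u ^ 2 * (9 * (Nat.log 2 N + 1))) : ℕ) : ℝ) := by exact_mod_cast h1
      _ = 13824 * ((Nat.log 2 N : ℝ) + 1) * (u : ℝ) ^ 2 := by push_cast; ring
      _ ≤ 13824 * L * u ^ 3 := by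
          have hL0 : 0 ≤ L := le_trans (by positivity) hL
          gcongr
          norm_num
  have hsmall : ((({d ∈ Finset.Ioc u (u ^ 3) | Squarefree d}.biUnion
        fun d => {n ∈ Finset.Icc 1 N | d ∣ badProd n}).card : ℕ) : ℝ) ≤ 17 * K * u ^ 3 := by
    calc _ ≤ ((∑ d ∈ {d ∈ Finset.Ioc u (u ^ 3) | Squarefree d},
            {n ∈ Finset.Icc 1 N | d ∣ badProd n}.card : ℕ) : ℝ) := by
          exact_mod_cast Finset.card_biUnion_le
      _ = ∑ d ∈ {d ∈ Finset.Ioc u (u ^ 3) | Squarefree d},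
            ({n ∈ Finset.Icc 1 N | d ∣ badProd n}.card : ℝ) := by push_cast; rfl
      _ ≤ ∑ d ∈ {d ∈ Finset.Ioc u (u ^ 3) | Squarefree d},
            (N * (K * ((d : ℝ) ^ 2)⁻¹) + K) := by
          refine Finset.sum_le_sum fun d hd => ?_
          rw [Finset.mem_filter, Finset.mem_Ioc] at hd
          have h1 := (abs_le.1 (abs_card_filter_dvd_badProd_sub_le hd.2 N)).2
          have h2 : (classCount d : ℝ) ≤ K := le_trans (by exact_mod_cast classCount_le d)
            (hK d (by omega) (by omega))
          have h3 : (N : ℝ) * (classCount d / (d : ℝ) ^ 2) ≤ N * (K * ((d : ℝ) ^ 2)⁻¹) := by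
            rw [div_eq_mul_inv]
            gcongr
          linarith
      _ ≤ ∑ d ∈ Finset.Ioc u (u ^ 3), (N * (K * ((d : ℝ) ^ 2)⁻¹) + K) :=
          Finset.sum_le_sum_of_subset_of_nonneg (Finset.filter_subset _ _)
            fun d _ _ => by positivity
      _ = N * (K * ∑ d ∈ Finset.Ioc u (u ^ 3), ((d : ℝ) ^ 2)⁻¹) + ((u ^ 3 - u : ℕ) : ℝ) * K := by
          rw [Finset.sum_add_distrib, Finset.sum_const, Nat.card_Ioc, nsmul_eq_mul,
            Finset.mul_sum, Finset.mul_sum]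
      _ ≤ (16 * (u : ℝ) ^ 4) * (K * (u : ℝ)⁻¹) + (u : ℝ) ^ 3 * K := by
          have h1 : ∑ d ∈ Finset.Ioc u (u ^ 3), ((d : ℝ) ^ 2)⁻¹ ≤ (u : ℝ)⁻¹ :=
            (sum_Ioc_inv_sq_le_sub hu.ne' (Nat.le_self_pow (by norm_num) u)).trans
              (sub_le_self _ (by positivity))
          have h2 : ((u ^ 3 - u : ℕ) : ℝ) ≤ (u : ℝ) ^ 3 := by
            exact_mod_cast Nat.sub_le _ _
          gcongr
      _ = 17 * K * u ^ 3 := by field_simp; ring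
  calc _ ≤ (((({d ∈ Finset.Ioc u (u ^ 3) | Squarefree d}.biUnion
        fun d => {n ∈ Finset.Icc 1 N | d ∣ badProd n}) ∪ (Finset.Icc 1 3).biUnion
        fun i => {n ∈ Finset.Icc 1 N | ∃ d, u ^ 3 < d ∧ d ^ 2 ∣ n ^ 2 + i}).card : ℕ) : ℝ) := by
        exact_mod_cast Finset.card_le_card hsub
    _ ≤ 17 * K * u ^ 3 + 13824 * L * u ^ 3 := by
        refine le_trans (by exact_mod_cast Finset.card_union_le _ _) (add_le_add hsmall hlarge)
    _ = _ := by ring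

/-- The Legendre sieve at level `u³`: the divisors `d ≤ u³` of `badProd n` give the main term, and
the remaining ones only occur for the few `n` with `u³ < badProd n`. -/
theorem abs_nearSquareCount_natCast_sub_le {N u : ℕ} {K L C : ℝ} (hu : 0 < u) (hlo : u ^ 4 ≤ N)
    (hhi : N ≤ 16 * u ^ 4)
    (hK : ∀ d : ℕ, 0 < d → d ≤ 64 * N ^ 6 → (6 : ℝ) ^ d.primeFactors.card ≤ K)
    (hL : (Nat.log 2 N : ℝ) + 1 ≤ L)
    (hC : |(∑' d, densityTerm d) - ∑ d ∈ Finset.Icc 1 (u ^ 3), densityTerm d| ≤ C / u) :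
    |(nearSquareCount (N : ℝ) : ℝ) - (∑' d, densityTerm d) * N| ≤
      (K + K * (17 * K + 13824 * L) + 16 * C) * u ^ 3 := by
  have hN : 0 < N := lt_of_lt_of_le (by positivity) hlo
  have huN : u ^ 3 ≤ 64 * N ^ 6 := by
    have h1 : u ^ 3 ≤ u ^ 4 := Nat.pow_le_pow_right hu (by norm_num)
    have h2 : N ≤ N ^ 6 := Nat.le_self_pow (by norm_num) N
    omega
  have hu' : (1 : ℝ) ≤ u := by exact_mod_cast hu
  have hhi' : (N : ℝ) ≤ 16 * (u : ℝ) ^ 4 := by exact_mod_cast hhi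
  have hK0 : 0 ≤ K :=
    le_trans (by positivity) (hK 1 one_pos (by nlinarith [Nat.pow_pos (n := 6) hN]))
  set μ : ℕ → ℝ := fun d => (ArithmeticFunction.moebius d : ℝ) with hμ
  have hexpand : (nearSquareCount (N : ℝ) : ℝ) =
      (∑ d ∈ Finset.Icc 1 (u ^ 3), μ d * ({n ∈ Finset.Icc 1 N | d ∣ badProd n}.card : ℝ)) +
      ∑ n ∈ Finset.Icc 1 N, ∑ d ∈ (badProd n).divisors with ¬ d ≤ u ^ 3, μ d := by
    have h1 : (nearSquareCount (N : ℝ) : ℝ) =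
        ∑ n ∈ Finset.Icc 1 N, ∑ d ∈ (badProd n).divisors, μ d := by
      rw [nearSquareCount, Nat.floor_natCast, Finset.sum_congr rfl fun n _ => moebius_sq_mul_eq_sum n]
      push_cast
      rfl
    have h2 : ∀ n, ∑ d ∈ (badProd n).divisors with d ≤ u ^ 3, μ d =
        ∑ d ∈ Finset.Icc 1 (u ^ 3), if d ∣ badProd n then μ d else 0 := by
      intro n
      rw [← Finset.sum_filter]
      refine Finset.sum_congr ?_ fun _ _ => rfl
      ext d
      simp only [Finset.mem_filter, Nat.mem_divisors, Finset.mem_Icc]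
      constructor
      · rintro ⟨⟨h, h0⟩, h3⟩
        exact ⟨⟨Nat.pos_of_dvd_of_pos h (badProd_pos n), h3⟩, h⟩
      · rintro ⟨⟨-, h3⟩, h⟩
        exact ⟨⟨h, (badProd_pos n).ne'⟩, h3⟩
    rw [h1, Finset.sum_congr rfl fun n _ =>
      (Finset.sum_filter_add_sum_filter_not (badProd n).divisors (fun d => d ≤ u ^ 3) μ).symm,
      Finset.sum_add_distrib, Finset.sum_congr rfl fun n _ => h2 n, Finset.sum_comm]
    congr 1
    refine Finset.sum_congr rfl fun d _ => ?_
    rw [← Finset.sum_filter, Finset.sum_const, nsmul_eq_mul, mul_comm]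
  have hmain : |(∑ d ∈ Finset.Icc 1 (u ^ 3), μ d * ({n ∈ Finset.Icc 1 N | d ∣ badProd n}.card : ℝ)) -
      N * ∑ d ∈ Finset.Icc 1 (u ^ 3), densityTerm d| ≤ K * u ^ 3 := by
    rw [Finset.mul_sum, ← Finset.sum_sub_distrib]
    refine (Finset.abs_sum_le_sum_abs _ _).trans ?_
    calc _ ≤ ∑ d ∈ Finset.Icc 1 (u ^ 3), K := by
          refine Finset.sum_le_sum fun d hd => ?_
          rw [Finset.mem_Icc] at hd
          by_cases hsq : Squarefree d
          · have h1 : μ d * ({n ∈ Finset.Icc 1 N | d ∣ badProd n}.card : ℝ) - N * densityTerm d =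
                μ d * (({n ∈ Finset.Icc 1 N | d ∣ badProd n}.card : ℝ) -
                  N * (classCount d / (d : ℝ) ^ 2)) := by
              rw [densityTerm]; ring
            rw [h1, abs_mul]
            calc _ ≤ 1 * (classCount d : ℝ) := mul_le_mul (abs_moebius_le_one_real d)
                  (abs_card_filter_dvd_badProd_sub_le hsq N) (abs_nonneg _) zero_le_one
              _ ≤ K := by
                  rw [one_mul]
                  exact le_trans (by exact_mod_cast classCount_le d) (hK d hd.1 (by omega))
          · have h0 : (ArithmeticFunction.moebius d : ℝ) = 0 := by
              rw [ArithmeticFunction.moebius_eq_zero_of_not_squarefree hsq, Int.cast_zero]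
            simp only [hμ, densityTerm, h0, zero_mul, mul_zero, sub_zero, abs_zero]
            exact hK0
      _ = K * u ^ 3 := by
          rw [Finset.sum_const, Nat.card_Icc, nsmul_eq_mul]; push_cast; ring
  have hrest : |∑ n ∈ Finset.Icc 1 N, ∑ d ∈ (badProd n).divisors with ¬ d ≤ u ^ 3, μ d| ≤
      K * ((17 * K + 13824 * L) * u ^ 3) := by
    calc _ ≤ ∑ n ∈ Finset.Icc 1 N, |∑ d ∈ (badProd n).divisors with ¬ d ≤ u ^ 3, μ d| :=
          Finset.abs_sum_le_sum_abs _ _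
      _ ≤ ∑ n ∈ Finset.Icc 1 N, if u ^ 3 < badProd n then K else 0 := by
          refine Finset.sum_le_sum fun n hn => ?_
          rw [Finset.mem_Icc] at hn
          split_ifs with h
          · calc _ ≤ ∑ d ∈ (badProd n).divisors with ¬ d ≤ u ^ 3, |μ d| :=
                  Finset.abs_sum_le_sum_abs _ _
              _ ≤ ∑ d ∈ (badProd n).divisors, |μ d| :=
                  Finset.sum_le_sum_of_subset_of_nonneg (Finset.filter_subset _ _)
                    fun _ _ _ => abs_nonneg _
              _ ≤ ∑ d ∈ (badProd n).divisors, (1 : ℝ) :=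
                  Finset.sum_le_sum fun d _ => abs_moebius_le_one_real d
              _ = ((badProd n).divisors.card : ℝ) := by simp
              _ ≤ (6 : ℝ) ^ (badProd n).primeFactors.card := by
                  exact_mod_cast card_divisors_le_of_squarefree (squarefree_badProd n)
              _ ≤ K := hK _ (badProd_pos n) ((badProd_le n hn.1).trans
                  (Nat.mul_le_mul_left _ (Nat.pow_le_pow_left hn.2 6)))
          · rw [Finset.filter_eq_empty_iff.2, Finset.sum_empty, abs_zero]
            intro d hd
            rw [not_not]
            exact (Nat.divisor_le hd).trans (not_lt.1 h)
      _ = K * ({n ∈ Finset.Icc 1 N | u ^ 3 < badProd n}.card : ℝ) := by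
          rw [← Finset.sum_filter, Finset.sum_const, nsmul_eq_mul, mul_comm]
      _ ≤ _ := mul_le_mul_of_nonneg_left (card_filter_lt_badProd_le hu hlo hhi hK hL) hK0
  have htail : |N * ((∑ d ∈ Finset.Icc 1 (u ^ 3), densityTerm d) - ∑' d, densityTerm d)| ≤
      16 * C * u ^ 3 := by
    rw [abs_mul, abs_sub_comm, abs_of_nonneg (Nat.cast_nonneg N)]
    calc _ ≤ (16 * (u : ℝ) ^ 4) * (C / u) := by gcongr
      _ = _ := by field_simp
  rw [hexpand]
  generalize (∑ d ∈ Finset.Icc 1 (u ^ 3),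
    μ d * ({n ∈ Finset.Icc 1 N | d ∣ badProd n}.card : ℝ)) = a at *
  generalize ∑ n ∈ Finset.Icc 1 N, ∑ d ∈ (badProd n).divisors with ¬ d ≤ u ^ 3, μ d = b at *
  generalize ∑ d ∈ Finset.Icc 1 (u ^ 3), densityTerm d = c at *
  rw [abs_le] at *
  constructor <;> linarith [hmain.1, hmain.2, hrest.1, hrest.2, htail.1, htail.2]

theorem exists_pow_four_le_le (N : ℕ) (hN : 0 < N) :
    ∃ u : ℕ, 0 < u ∧ u ^ 4 ≤ N ∧ N ≤ 16 * u ^ 4 := by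
  have h1 := Nat.sqrt_le' N
  have h2 := Nat.lt_succ_sqrt' N
  have h3 := Nat.sqrt_le' N.sqrt
  have h4 := Nat.lt_succ_sqrt' N.sqrt
  have hpos : 0 < N.sqrt.sqrt := Nat.sqrt_pos.2 (Nat.sqrt_pos.2 hN)
  generalize N.sqrt.sqrt = u at *
  generalize N.sqrt = v at *
  refine ⟨u, hpos, ?_, ?_⟩
  · calc u ^ 4 = (u ^ 2) ^ 2 := by ring
      _ ≤ v ^ 2 := Nat.pow_le_pow_left h3 2
      _ ≤ N := h1
  · calc N ≤ (v + 1) ^ 2 := h2.le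
      _ ≤ ((u + 1) ^ 2) ^ 2 := Nat.pow_le_pow_left h4 2
      _ ≤ ((2 * u) ^ 2) ^ 2 := by gcongr; omega
      _ = 16 * u ^ 4 := by ring

theorem exists_abs_nearSquareCount_natCast_sub_le {ε : ℝ} (hε : 0 < ε) :
    ∃ C : ℝ, 0 ≤ C ∧ ∀ N : ℕ, 0 < N →
      |(nearSquareCount (N : ℝ) : ℝ) - (∑' d, densityTerm d) * N| ≤
        C * (N : ℝ) ^ (3 / 4 + ε) := by
  set δ := ε / 12 with hδ
  have hδ0 : 0 < δ := by positivity
  obtain ⟨A, hA1, hA⟩ := exists_six_pow_card_primeFactors_le hδ0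
  obtain ⟨C, hC0, hC⟩ := exists_abs_tsum_densityTerm_sub_le
  set k := A * (64 : ℝ) ^ δ with hk
  set l := 1 / (6 * δ) / Real.log 2 + 1 with hl
  have hlog2 : 0 < Real.log 2 := Real.log_pos one_lt_two
  have hk0 : 0 ≤ k := by positivity
  have hl0 : 0 ≤ l := by positivity
  refine ⟨k + k * (17 * k + 13824 * l) + 16 * C, by positivity, fun N hN => ?_⟩
  obtain ⟨u, hu, hlo, hhi⟩ := exists_pow_four_le_le N hN
  have hN1 : (1 : ℝ) ≤ N := by exact_mod_cast hN
  set T := (N : ℝ) ^ (6 * δ) with hT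
  have hT1 : 1 ≤ T := Real.one_le_rpow hN1 (by positivity)
  have hK : ∀ d : ℕ, 0 < d → d ≤ 64 * N ^ 6 → (6 : ℝ) ^ d.primeFactors.card ≤ k * T := by
    intro d hd hdN
    calc _ ≤ A * (d : ℝ) ^ δ := hA d hd
      _ ≤ A * (64 * (N : ℝ) ^ 6) ^ δ := by
          gcongr
          exact_mod_cast hdN
      _ = k * T := by
          rw [Real.mul_rpow (by positivity) (by positivity), ← Real.rpow_natCast,
            ← Real.rpow_mul (by positivity), hk, hT]
          push_cast
          ring
  have hL : (Nat.log 2 N : ℝ) + 1 ≤ l * T := by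
    have h1 : (Nat.log 2 N : ℝ) ≤ Real.log N / Real.log 2 := Real.natLog_le_logb N 2
    have h2 : Real.log N ≤ T / (6 * δ) := Real.log_le_rpow_div (by positivity) (by positivity)
    calc _ ≤ T / (6 * δ) / Real.log 2 + T := by
          refine add_le_add (h1.trans ?_) hT1
          gcongr
      _ = l * T := by rw [hl]; ring
  have h := abs_nearSquareCount_natCast_sub_le hu hlo hhi hK hL (hC u hu)
  have hu3 : (u : ℝ) ^ 3 ≤ (N : ℝ) ^ (3 / 4 : ℝ) := by
    have h1 : (u : ℝ) ^ 4 ≤ N := by exact_mod_cast hlo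
    calc (u : ℝ) ^ 3 = ((u : ℝ) ^ 4) ^ (3 / 4 : ℝ) := by
          rw [← Real.rpow_natCast, ← Real.rpow_natCast, ← Real.rpow_mul (by positivity)]
          norm_num
      _ ≤ _ := Real.rpow_le_rpow (by positivity) h1 (by norm_num)
  have hTT : (N : ℝ) ^ (3 / 4 + ε) = T ^ 2 * (N : ℝ) ^ (3 / 4 : ℝ) := by
    rw [hT, ← Real.rpow_natCast, ← Real.rpow_mul (by positivity),
      ← Real.rpow_add (by positivity)]
    congr 1
    push_cast
    rw [hδ]; ring
  refine h.trans ?_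
  rw [hTT, ← mul_assoc (_ + 16 * C)]
  refine mul_le_mul ?_ hu3 (by positivity) (by positivity)
  have hT2 : T ≤ T ^ 2 := by nlinarith
  have hT3 : 1 ≤ T ^ 2 := by nlinarith
  calc k * T + k * T * (17 * (k * T) + 13824 * (l * T)) + 16 * C
      = k * T + k * (17 * k + 13824 * l) * T ^ 2 + 16 * C * 1 := by ring
    _ ≤ k * T ^ 2 + k * (17 * k + 13824 * l) * T ^ 2 + 16 * C * T ^ 2 := by gcongr
    _ = _ := by ring

theorem nearSquareCount_isBigO {ε : ℝ} (hε : 0 < ε) :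
    (fun X : ℝ => (nearSquareCount X : ℝ) - (∑' d, densityTerm d) * X)
      =O[atTop] (fun X : ℝ => X ^ (3 / 4 + ε)) := by
  obtain ⟨C, hC0, hC⟩ := exists_abs_nearSquareCount_natCast_sub_le hε
  set c := ∑' d, densityTerm d
  refine IsBigO.of_bound (C + |c|) ?_
  filter_upwards [eventually_ge_atTop 1] with X hX
  have hN : 0 < ⌊X⌋₊ := Nat.floor_pos.2 hX
  have h1 : nearSquareCount X = nearSquareCount (⌊X⌋₊ : ℝ) := by
    rw [nearSquareCount, nearSquareCount, Nat.floor_natCast]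
  have hle : (⌊X⌋₊ : ℝ) ≤ X := Nat.floor_le (by linarith)
  have hlt : X < ⌊X⌋₊ + 1 := Nat.lt_floor_add_one X
  have hX1 : 1 ≤ X ^ (3 / 4 + ε) := Real.one_le_rpow hX (by positivity)
  rw [Real.norm_eq_abs, Real.norm_of_nonneg (by positivity), h1]
  calc _ = |((nearSquareCount (⌊X⌋₊ : ℝ) : ℝ) - c * ⌊X⌋₊) + c * (⌊X⌋₊ - X)| := by congr 1; ring
    _ ≤ C * (⌊X⌋₊ : ℝ) ^ (3 / 4 + ε) + |c| * 1 := by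
        refine (abs_add_le _ _).trans (add_le_add (hC _ hN) ?_)
        rw [abs_mul]
        gcongr
        rw [abs_le]; constructor <;> linarith
    _ ≤ C * X ^ (3 / 4 + ε) + |c| * X ^ (3 / 4 + ε) := by gcongr
    _ = _ := by ring

/-- If only finitely many `n` occurred, the count would stay bounded, whereas its main term is a
positive multiple of `X` and the error term is `o(X)`. -/
theorem infinite_squarefree_triples :
    {n : ℕ | 0 < n ∧ Squarefree (n ^ 2 + 1) ∧ Squarefree (n ^ 2 + 2) ∧
      Squarefree (n ^ 2 + 3)}.Infinite := by
  intro hfin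
  have hcpos : 0 < ∑' d, densityTerm d := by
    rw [tsum_densityTerm_eq]
    exact mul_pos (by norm_num) tprod_eulerFactor_pos
  set c := ∑' d, densityTerm d
  have hbound : ∀ X : ℝ, (nearSquareCount X : ℝ) ≤ hfin.toFinset.card := by
    intro X
    have h : nearSquareCount X ≤ hfin.toFinset.card := by
      rw [nearSquareCount]
      calc _ = ∑ n ∈ Finset.Icc 1 ⌊X⌋₊, if n ∈ hfin.toFinset then (1 : ℤ) else 0 := by
            refine Finset.sum_congr rfl fun n hn => ?_
            rw [Finset.mem_Icc] at hn
            simp only [ArithmeticFunction.moebius_sq, Set.Finite.mem_toFinset, Set.mem_ofPred_eq]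
            have : 0 < n := hn.1
            split_ifs <;> simp_all
        _ = (((Finset.Icc 1 ⌊X⌋₊).filter (· ∈ hfin.toFinset)).card : ℤ) := by
            rw [← Finset.sum_filter, Finset.sum_const, nsmul_eq_mul, mul_one]
        _ ≤ hfin.toFinset.card := by
            exact_mod_cast Finset.card_le_card fun n hn => (Finset.mem_filter.1 hn).2
    exact_mod_cast h
  have ho : (fun X : ℝ => (nearSquareCount X : ℝ) - c * X) =o[atTop] (fun X : ℝ => X) := by
    refine (nearSquareCount_isBigO (ε := 1 / 8) (by norm_num)).trans_isLittleO ?_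
    refine (isLittleO_iff_tendsto' ?_).2 ?_
    · filter_upwards [eventually_gt_atTop 0] with X hX h
      exact absurd h hX.ne'
    · refine (tendsto_rpow_neg_atTop (y := 1 / 8) (by norm_num)).congr' ?_
      filter_upwards [eventually_gt_atTop 0] with X hX
      rw [← Real.rpow_sub_one hX.ne']
      norm_num
  have hev := (ho.bound (half_pos hcpos)).and
    ((eventually_gt_atTop ((hfin.toFinset.card : ℝ) / (c / 2))).and (eventually_gt_atTop 0))
  obtain ⟨X, h1, h2, h3⟩ := hev.exists
  rw [Real.norm_eq_abs, Real.norm_of_nonneg h3.le, abs_le] at h1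
  rw [div_lt_iff₀ (half_pos hcpos)] at h2
  linarith [h1.1, hbound X]

theorem proposition1 :
    Multipliable
      (fun p : {p : ℕ // p.Prime ∧ 3 < p} => @eulerFactor (p : ℕ) ⟨p.property.1⟩) ∧
    (∀ ε : ℝ, 0 < ε →
      (fun X : ℝ => (nearSquareCount X : ℝ) -
        7 / 18 * (∏' p : {p : ℕ // p.Prime ∧ 3 < p}, @eulerFactor (p : ℕ) ⟨p.property.1⟩) * X)
        =O[atTop] (fun X : ℝ => X ^ (3 / 4 + ε))) ∧
    {n : ℕ | 0 < n ∧ Squarefree (n ^ 2 + 1) ∧ Squarefree (n ^ 2 + 2) ∧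
      Squarefree (n ^ 2 + 3)}.Infinite := by
  refine ⟨multipliable_eulerFactor, fun ε hε => ?_, infinite_squarefree_triples⟩
  rw [← tsum_densityTerm_eq]
  exact nearSquareCount_isBigO hε
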